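/- Let $k$ be a field, let $R=k[x_0,x_1,x_2]$, and for a finite set $X$ of ($k$-rational) points of $\mathbb P^2$ over $k$ let $I(X)\subset R$ be the homogeneous ideal generated by the forms vanishing on $X$. The double point scheme $Z=2X$ is the subscheme of $\mathbb P^2$ whose saturated ideal $I(Z)$ is the saturation of $I(X)^2$ with respect to $(x_0,x_1,x_2)$. For $W=X$ or $W=Z$ write $h_W(d)=\dim_k (R/I(W))_d$ and $\Delta h_W(d)=h_W(d)-h_W(d-1)$, where $h_W(-1)=0$. Let $C\subset\mathbb P^2$ be a cubic curve defined by an irreducible form $F\in R$ of degree $3$, let $t\ge 3$, and let $X$ be a set of $3t$ distinct points on $C$ such that $$\Delta h_X(0)=1,\quad \Delta h_X(1)=2,\quad \Delta h_X(d)=3\ (2\le d\le t-1),\quad \Delta h_X(t)=2,\quad \Delta h_X(t+1)=1,\quad \Delta h_X(d)=0\ (d\ge t+2).$$ Then: 1. $X$ is a complete intersection with ideal $I(X)=(F,G)$ for some form $G$ of degree $t$ (that is, $F,G$ is a regular sequence generating $I(X)$). 2. No singular point of $C$ is a point of $X$. 3. The difference function $(\Delta h_Z(0),\Delta h_Z(1),\dots)$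 of $Z=2X$ is - for $t=3$: $1,2,3,4,5,6,4,2,0,0,\dots$; - for $t=4$: $1,2,3,4,5,6,6,5,3,1,0,0,\dots$; - for $t=5$: $1,2,3,4,5,6,6,6,5,4,2,1,0,0,\dots$; - for $t\ge 6$: $\Delta h_Z(d)=d+1$ for $0\le d\le 5$; $6$ for $5\le d\le t+2$; $5$ for $d=t+3$; $4$ for $d=t+4$; $3$ for $t+5\le d\le 2t-1$; $2$ for $d=2t$; $1$ for $d=2t+1$; and $0$ for $d\ge 2t+2$. -/

import Mathlib

open MvPolynomial

namespace FatPoints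

/-- The homogeneous coordinate ring `k[x₀, x₁, x₂]` of the projective plane over `k`. -/
abbrev CoordRing (k : Type*) [Field k] : Type _ := MvPolynomial (Fin 3) k

/-- The (`k`-rational) points of the projective plane over `k`. -/
abbrev Plane (k : Type*) [Field k] : Type _ := Projectivization k (Fin 3 → k)

variable {k : Type*} [Field k]

/-- The form `f` vanishes at the point `P`. For homogeneous `f` this does not depend on the
representative of `P`; it is only used for homogeneous `f`. -/
def VanishesAt (f : CoordRing k) (P : Plane k) : Prop :=
  eval P.rep f = 0

/-- The homogeneous ideal `I(X)` of a finite (reduced) set `X` of points of the plane: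
the ideal generated by all forms vanishing at every point of `X`. -/
noncomputable def pointsIdeal (X : Finset (Plane k)) : Ideal (CoordRing k) :=
  Ideal.span {f | (∃ d : ℕ, f.IsHomogeneous d) ∧ ∀ P ∈ X, VanishesAt f P}

/-- The saturation of an ideal `J` with respect to the ideal `𝔪 = (x₀, x₁, x₂)`,
that is, the union of the ascending chain of the ideals `J : 𝔪 ^ N`. -/
noncomputable def saturation (J : Ideal (CoordRing k)) : Ideal (CoordRing k) :=
  ⨆ N : ℕ, Submodule.colon J ((idealOfVars (Fin 3) k ^ N : Ideal (CoordRing k)) : Set (CoordRing k))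

/-- The saturated ideal of the fat point scheme `mX`: the symbolic power `I(X)^(m)`, i.e. the
saturation of `I(X) ^ m`. -/
noncomputable def fatPointIdeal (m : ℕ) (X : Finset (Plane k)) : Ideal (CoordRing k) :=
  saturation (pointsIdeal X ^ m)

/-- The Hilbert function of `R / I`, `R = k[x₀, x₁, x₂]`: the dimension over `k` of the degree `d`
component of `R / I`, which is the image of the space of forms of degree `d`. For the saturated
ideal `I` of a subscheme of the plane this is the Hilbert function of the subscheme. -/
noncomputable def hilbertFun (I : Ideal (CoordRing k)) (d : ℕ) : ℕ :=
  Module.finrank k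
    ((homogeneousSubmodule (Fin 3) k d).map (Ideal.Quotient.mkₐ k I).toLinearMap)

/-- The difference function `Δh(d) = h(d) - h(d - 1)`, where `h(-1) = 0`. -/
noncomputable def diffFun (I : Ideal (CoordRing k)) : ℕ → ℤ
  | 0 => hilbertFun I 0
  | d + 1 => (hilbertFun I (d + 1) : ℤ) - hilbertFun I d

/-- `P` is a singular point of the plane curve defined by the form `F`. -/
def IsSingularPoint (F : CoordRing k) (P : Plane k) : Prop :=
  VanishesAt F P ∧ ∀ i : Fin 3, VanishesAt (pderiv i F) P

/-- The sequence `1, 2, 3, …, 3, 2, 1, 0, 0, …`, for `t ≥ 3`, with the value `3` in the degrees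
`2, …, t - 1`, the value `2` in degree `t` and the value `1` in degree `t + 1`. -/
def ciSeq (t d : ℕ) : ℤ :=
  if d = 0 then 1
  else if d = 1 then 2
  else if d < t then 3
  else if d = t then 2
  else if d = t + 1 then 1
  else 0

/-- The sequence, for `t ≥ 6`, with the values
`1, 2, 3, 4, 5, 6` in degrees `0, …, 5`, then `6` up to degree `t + 2`, `5` in degree `t + 3`,
`4` in degree `t + 4`, `3` in the degrees `t + 5, …, 2t - 1`, `2` in degree `2t`,
`1` in degree `2t + 1`, and `0` from degree `2t + 2` on. -/
def doubleSeq (t d : ℕ) : ℤ :=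
  if d ≤ 5 then d + 1
  else if d ≤ t + 2 then 6
  else if d = t + 3 then 5
  else if d = t + 4 then 4
  else if d < 2 * t then 3
  else if d = 2 * t then 2
  else if d = 2 * t + 1 then 1
  else 0

end FatPoints

/-! Write I = I(X). The given Hilbert function makes dim I_t one more than the dimension of the
multiples of F of degree t, so some form G in I_t is not divisible by F. As F is prime, (F, G) is a
complete intersection; it lies in I and has the same Hilbert function, hence equals I
(`exists_pointsIdeal_eq_span_pair`).

If F were singular at P in X, a tangent direction killed by dG at P would be killed by every element
of I, contradicting that X is reduced at P (`not_isSingularPoint_of_mem`).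

If aF + bG is in I², then a and b are in I (`mem_of_add_mem_sq`), so I² inherits saturation from I,
and I(2X) = I². Finally I² = F·I + (G²), with F·I ∩ (G²) = (FG²), which gives the Hilbert function
of 2X (`pieceDim_of_prime`). -/

namespace FatPoints

variable {k : Type*} [Field k]

/-! ### Forms and homogeneous components in integer degrees. -/

/-- The space of forms of degree `z`, for an integer `z`; it is zero for `z < 0`. -/
noncomputable def forms (k : Type*) [Field k] (z : ℤ) : Submodule k (CoordRing k) :=
  if 0 ≤ z then homogeneousSubmodule (Fin 3) k z.toNat else ⊥

/-- The component of degree `z` of a polynomial, for an integer `z`. -/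
noncomputable def homComp (z : ℤ) : CoordRing k →ₗ[k] CoordRing k :=
  if 0 ≤ z then homogeneousComponent z.toNat else 0

theorem forms_natCast (n : ℕ) : forms k (n : ℤ) = homogeneousSubmodule (Fin 3) k n := by
  simp [forms]

theorem forms_of_neg {z : ℤ} (hz : z < 0) : forms k z = ⊥ := by
  simp [forms, hz]

theorem homComp_natCast (n : ℕ) (f : CoordRing k) :
    homComp (n : ℤ) f = homogeneousComponent n f := by
  simp [homComp]

theorem homComp_of_neg {z : ℤ} (hz : z < 0) (f : CoordRing k) : homComp z f = 0 := by
  simp [homComp, not_le.2 hz]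

theorem homComp_mem_forms (z : ℤ) (f : CoordRing k) : homComp z f ∈ forms k z := by
  rcases lt_or_ge z 0 with hz | hz
  · simp [homComp_of_neg hz]
  · lift z to ℕ using hz
    rw [homComp_natCast, forms_natCast]
    exact homogeneousComponent_mem _ _

theorem homComp_eq_self {z : ℤ} {f : CoordRing k} (hf : f ∈ forms k z) : homComp z f = f := by
  rcases lt_or_ge z 0 with hz | hz
  · rw [forms_of_neg hz, Submodule.mem_bot] at hf
    simp [hf]
  · lift z to ℕ using hz
    rw [forms_natCast] at hf
    rw [homComp_natCast]
    exact homogeneousComponent_eq_self hf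

theorem mul_mem_forms {f g : CoordRing k} {e : ℕ} {z : ℤ} (hf : f.IsHomogeneous e)
    (hg : g ∈ forms k (z - e)) : f * g ∈ forms k z := by
  rcases lt_or_ge (z - e) 0 with hz | hz
  · rw [forms_of_neg hz, Submodule.mem_bot] at hg
    simp [hg]
  · obtain ⟨n, hn⟩ := Int.eq_ofNat_of_zero_le hz
    obtain rfl : z = ((e + n : ℕ) : ℤ) := by push_cast; omega
    rw [hn, forms_natCast] at hg
    rw [forms_natCast]
    exact hf.mul hg

attribute [local instance] MvPolynomial.gradedAlgebra

theorem homogeneousComponent_mul_of_le {f : CoordRing k} {e n : ℕ} (hf : f.IsHomogeneous e)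
    (h : e ≤ n) (g : CoordRing k) :
    homogeneousComponent n (f * g) = f * homogeneousComponent (n - e) g := by
  rw [← decomposition.decompose'_apply, ← decomposition.decompose'_apply]
  exact DirectSum.coe_decompose_mul_of_left_mem_of_le (homogeneousSubmodule (Fin 3) k) hf h

theorem homogeneousComponent_mul_of_lt {f : CoordRing k} {e n : ℕ} (hf : f.IsHomogeneous e)
    (h : n < e) (g : CoordRing k) : homogeneousComponent n (f * g) = 0 := by
  rw [← decomposition.decompose'_apply]
  exact DirectSum.coe_decompose_mul_of_left_mem_of_not_le (homogeneousSubmodule (Fin 3) k) hf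
    (not_le.2 h)

/-- Integer degrees keep this uniform: for `z < e` both sides are zero, with no truncated
subtraction. -/
theorem homComp_mul {f : CoordRing k} {e : ℕ} (hf : f.IsHomogeneous e) (z : ℤ)
    (g : CoordRing k) : homComp z (f * g) = f * homComp (z - e) g := by
  rcases lt_or_ge z 0 with hz | hz
  · rw [homComp_of_neg hz, homComp_of_neg (by omega), mul_zero]
  · lift z to ℕ using hz
    rw [homComp_natCast]
    rcases lt_or_ge z e with h | h
    · rw [homComp_of_neg (by omega), mul_zero, homogeneousComponent_mul_of_lt hf h]
    · rw [← Nat.cast_sub h, homComp_natCast, homogeneousComponent_mul_of_le hf h]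

/-- The ideal `I` is homogeneous: it contains the homogeneous components of its elements. -/
def HasComponents (I : Ideal (CoordRing k)) : Prop :=
  ∀ f ∈ I, ∀ z : ℤ, homComp z f ∈ I

theorem hasComponents_span {S : Set (CoordRing k)} (hS : ∀ f ∈ S, ∃ d : ℕ, f.IsHomogeneous d) :
    HasComponents (Ideal.span S) := by
  intro f hf z
  rcases lt_or_ge z 0 with hz | hz
  · simp [homComp_of_neg hz]
  · lift z to ℕ using hz
    rw [homComp_natCast]
    exact homogeneousComponent_mem_of_mem (Ideal.homogeneous_span _ _ fun x hx => hS x hx) hf z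

instance finite_forms (z : ℤ) : Module.Finite k (forms k z) := by
  rcases lt_or_ge z 0 with hz | hz
  · rw [forms_of_neg hz]; infer_instance
  · lift z to ℕ using hz
    rw [forms_natCast]
    exact Module.Finite.of_fg (homogeneousSubmodule_fg _ _ _)

theorem finrank_forms_natCast (n : ℕ) : Module.finrank k (forms k (n : ℤ)) = (n + 2).choose 2 := by
  have h : homogeneousSubmodule (Fin 3) k n = restrictSupport k {d : Fin 3 →₀ ℕ | d.degree = n} :=
    homogeneousSubmodule_eq_finsupp_supported _ _ _
  rw [forms_natCast, h, Module.finrank_eq_nat_card_basis (basisRestrictSupport k _)]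
  have h2 : {d : Fin 3 →₀ ℕ | d.degree = n} =
      ((Finset.univ : Finset (Fin 3)).finsuppAntidiag n : Set (Fin 3 →₀ ℕ)) := by
    ext d
    simp [Finset.mem_finsuppAntidiag, Finsupp.degree_eq_sum]
  rw [h2, Nat.card_coe_set_eq, Set.ncard_coe_finset, Finset.card_finsuppAntidiag_nat_eq_choose]
  simp only [Finset.card_univ, Fintype.card_fin]
  rw [show 3 + n - 1 = n + 2 by omega, ← Nat.choose_symm_add]

/-- The dimension of the space of forms of degree `z`. -/
noncomputable def formsDim (k : Type*) [Field k] (z : ℤ) : ℤ :=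
  Module.finrank k (forms k z)

theorem formsDim_of_neg {z : ℤ} (hz : z < 0) : formsDim k z = 0 := by
  rw [formsDim, forms_of_neg hz]; simp

/-- The `max` covers negative degrees too, so that later dimension counts become linear arithmetic
for `omega`. -/
theorem formsDim_sub (z : ℤ) : formsDim k z - formsDim k (z - 1) = max (z + 1) 0 := by
  rcases lt_or_ge z 0 with hz | hz
  · rw [formsDim_of_neg hz, formsDim_of_neg (by omega)]; omega
  · lift z to ℕ using hz
    cases z with
    | zero =>
      rw [formsDim_of_neg (z := ((0 : ℕ) : ℤ) - 1) (by simp), formsDim, finrank_forms_natCast]; simp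
    | succ n =>
      rw [show ((n + 1 : ℕ) : ℤ) - 1 = (n : ℕ) by push_cast; ring, formsDim, formsDim,
        finrank_forms_natCast, finrank_forms_natCast, show n + 1 + 2 = (n + 2) + 1 by ring,
        Nat.choose_succ_succ' (n + 2) 1]
      push_cast
      simp
      omega

/-! ### Graded pieces of ideals and Hilbert functions. -/

/-- The forms of degree `z` in an ideal. -/
noncomputable def piece (I : Ideal (CoordRing k)) (z : ℤ) : Submodule k (CoordRing k) :=
  I.restrictScalars k ⊓ forms k z

theorem mem_piece {I : Ideal (CoordRing k)} {z : ℤ} {f : CoordRing k} :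
    f ∈ piece I z ↔ f ∈ I ∧ f ∈ forms k z := Iff.rfl

instance finite_piece (I : Ideal (CoordRing k)) (z : ℤ) : Module.Finite k (piece I z) :=
  Submodule.finiteDimensional_of_le (inf_le_right : piece I z ≤ forms k z)

/-- The dimension of the space of forms of degree `z` in an ideal. -/
noncomputable def pieceDim (I : Ideal (CoordRing k)) (z : ℤ) : ℤ :=
  Module.finrank k (piece I z)

theorem pieceDim_top (z : ℤ) : pieceDim (⊤ : Ideal (CoordRing k)) z = formsDim k z := by
  rw [pieceDim, formsDim, piece, Submodule.restrictScalars_top, top_inf_eq]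

theorem pieceDim_of_neg (I : Ideal (CoordRing k)) {z : ℤ} (hz : z < 0) : pieceDim I z = 0 := by
  rw [pieceDim, piece, forms_of_neg hz]; simp

theorem hilbertFun_eq (I : Ideal (CoordRing k)) (d : ℕ) :
    (hilbertFun I d : ℤ) = formsDim k d - pieceDim I d := by
  have h := LinearMap.finrank_range_add_finrank_ker
    ((Ideal.Quotient.mkₐ k I).toLinearMap.domRestrict (forms k (d : ℤ)))
  rw [LinearMap.range_domRestrict] at h
  have hmap : (LinearMap.ker ((Ideal.Quotient.mkₐ k I).toLinearMap.domRestrict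
      (forms k (d : ℤ)))).map (forms k (d : ℤ)).subtype = piece I d := by
    ext f
    simp [mem_piece, Ideal.Quotient.eq_zero_iff_mem, and_comm]
  have hker : Module.finrank k
      (LinearMap.ker ((Ideal.Quotient.mkₐ k I).toLinearMap.domRestrict (forms k (d : ℤ)))) =
      Module.finrank k (piece I d) := by
    rw [← Submodule.finrank_map_subtype_eq, hmap]
  rw [hilbertFun, formsDim, pieceDim, ← hker, ← h, forms_natCast]
  push_cast
  ring

theorem diffFun_eq (I : Ideal (CoordRing k)) (d : ℕ) :
    diffFun I d = max ((d : ℤ) + 1) 0 - (pieceDim I d - pieceDim I (d - 1)) := by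
  rw [← formsDim_sub (k := k)]
  cases d with
  | zero =>
    rw [diffFun, hilbertFun_eq, formsDim_of_neg (z := ((0 : ℕ) : ℤ) - 1) (by simp),
      pieceDim_of_neg (z := ((0 : ℕ) : ℤ) - 1) _ (by simp)]
    ring
  | succ n =>
    rw [diffFun, hilbertFun_eq, hilbertFun_eq, show ((n + 1 : ℕ) : ℤ) - 1 = (n : ℕ) by
      push_cast; ring]
    ring

theorem eq_of_piece_le {I J : Ideal (CoordRing k)} (hI : HasComponents I)
    (h : ∀ z, piece I z ≤ piece J z) : I ≤ J := by
  intro f hf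
  rw [← sum_homogeneousComponent f]
  refine Ideal.sum_mem _ fun i _ => ?_
  rw [← homComp_natCast]
  exact (h i (mem_piece.2 ⟨hI f hf i, homComp_mem_forms _ _⟩)).1

/-- A homogeneous ideal is determined by a homogeneous subideal with the same Hilbert function. -/
theorem eq_of_le_of_pieceDim_eq {I J : Ideal (CoordRing k)} (hJ : HasComponents J)
    (hle : I ≤ J) (h : ∀ z, pieceDim I z = pieceDim J z) : I = J := by
  refine le_antisymm hle (eq_of_piece_le hJ fun z => ?_)
  have hz : piece I z ≤ piece J z := fun f hf => ⟨hle hf.1, hf.2⟩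
  refine (Submodule.eq_of_le_of_finrank_eq hz ?_).ge
  have := h z
  rw [pieceDim, pieceDim] at this
  exact_mod_cast this

/-- Multiplication by `f`, as a `k`-linear map. -/
noncomputable abbrev mulLin (f : CoordRing k) : CoordRing k →ₗ[k] CoordRing k :=
  LinearMap.mulLeft k f

theorem finrank_map_mulLin {f : CoordRing k} (hf : f ≠ 0) (V : Submodule k (CoordRing k)) :
    Module.finrank k (V.map (mulLin f)) = Module.finrank k V :=
  (Submodule.equivMapOfInjective (mulLin f) (fun _ _ h => mul_left_cancel₀ hf h) V).finrank_eq.symm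

/-- The dimensions of the graded pieces of `F • J₀ + (B)`, for a prime form `F` not dividing the
form `B ∈ J₀`. -/
theorem pieceDim_of_prime {F B : CoordRing k} {e b : ℕ} (hF : F.IsHomogeneous e) (hFp : Prime F)
    (hB : B.IsHomogeneous b) (hFB : ¬ F ∣ B) {J₀ J : Ideal (CoordRing k)}
    (hJ₀ : HasComponents J₀) (hBJ : B ∈ J₀)
    (hJ : ∀ f, f ∈ J ↔ ∃ j ∈ J₀, ∃ r, f = F * j + B * r) (z : ℤ) :
    pieceDim J z = pieceDim J₀ (z - e) + formsDim k (z - b) - formsDim k (z - e - b) := by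
  have hB0 : B ≠ 0 := fun h => hFB (h ▸ dvd_zero F)
  have hsup : piece J z = (piece J₀ (z - e)).map (mulLin F) ⊔ (forms k (z - b)).map (mulLin B) := by
    apply le_antisymm
    · rintro f ⟨hf, hfz⟩
      obtain ⟨j, hj, r, rfl⟩ := (hJ f).1 hf
      rw [← homComp_eq_self hfz, map_add, homComp_mul hF, homComp_mul hB]
      exact Submodule.add_mem_sup ⟨_, ⟨hJ₀ _ hj _, homComp_mem_forms _ _⟩, rfl⟩
        ⟨_, homComp_mem_forms _ _, rfl⟩
    · refine sup_le ?_ ?_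
      · rintro _ ⟨j, ⟨hj, hjz⟩, rfl⟩
        exact ⟨(hJ _).2 ⟨j, hj, 0, by simp⟩, mul_mem_forms hF hjz⟩
      · rintro _ ⟨r, hr, rfl⟩
        exact ⟨(hJ _).2 ⟨0, J₀.zero_mem, r, by simp⟩, mul_mem_forms hB hr⟩
  -- If `F * j = B * r`, then the prime `F` divides `r`, so the common element is a multiple of `F *
  -- B`. The converse inclusion needs `B ∈ J₀`.
  have hinf : (piece J₀ (z - e)).map (mulLin F) ⊓ (forms k (z - b)).map (mulLin B) =
      (forms k (z - e - b)).map (mulLin (F * B)) := by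
    apply le_antisymm
    · rintro _ ⟨⟨j, ⟨-, hj⟩, rfl⟩, ⟨r, hr, h⟩⟩
      simp only [LinearMap.mulLeft_apply] at h
      obtain ⟨s, rfl⟩ := (hFp.dvd_or_dvd (h ▸ dvd_mul_right F j : F ∣ B * r)).resolve_left hFB
      have hj2 : j = B * s := mul_left_cancel₀ hFp.ne_zero (by rw [← h]; ring)
      refine ⟨homComp (z - e - b) s, homComp_mem_forms _ _, ?_⟩
      simp only [LinearMap.mulLeft_apply]
      rw [mul_assoc, ← homComp_mul hB, ← hj2, homComp_eq_self hj]
    · rintro _ ⟨s, hs, rfl⟩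
      refine ⟨⟨B * s, ⟨J₀.mul_mem_right _ hBJ, mul_mem_forms hB hs⟩, ?_⟩,
        ⟨F * s, mul_mem_forms hF ?_, ?_⟩⟩
      · simp
      · rwa [show z - b - e = z - e - b by ring]
      · simp only [LinearMap.mulLeft_apply]; ring
  have h := Submodule.finrank_sup_add_finrank_inf_eq ((piece J₀ (z - e)).map (mulLin F))
    ((forms k (z - b)).map (mulLin B))
  rw [← hsup, hinf, finrank_map_mulLin hFp.ne_zero, finrank_map_mulLin hB0,
    finrank_map_mulLin (mul_ne_zero hFp.ne_zero hB0)] at h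
  rw [pieceDim, pieceDim, formsDim, formsDim]
  omega

/-! ### Ideals of points: saturation and separating forms. -/

theorem eval_eq_zero_of_mem_pointsIdeal {X : Finset (Plane k)} {f : CoordRing k}
    (hf : f ∈ pointsIdeal X) {P : Plane k} (hP : P ∈ X) : eval P.rep f = 0 := by
  have h : pointsIdeal X ≤ RingHom.ker (eval P.rep) :=
    Ideal.span_le.2 fun g hg => hg.2 P hP
  exact h hf

theorem mem_pointsIdeal_of_form {X : Finset (Plane k)} {f : CoordRing k} {d : ℕ}
    (hd : f.IsHomogeneous d) (hf : ∀ P ∈ X, VanishesAt f P) : f ∈ pointsIdeal X :=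
  Ideal.subset_span ⟨⟨d, hd⟩, hf⟩

theorem hasComponents_pointsIdeal (X : Finset (Plane k)) : HasComponents (pointsIdeal X) :=
  hasComponents_span fun _ hf => hf.1

theorem saturation_eq_self {J : Ideal (CoordRing k)}
    (h : ∀ f, ∀ N : ℕ, (∀ m ∈ idealOfVars (Fin 3) k ^ N, m * f ∈ J) → f ∈ J) :
    saturation J = J := by
  apply le_antisymm
  · refine iSup_le fun N f hf => h f N fun m hm => ?_
    rw [mul_comm]
    exact Submodule.mem_colon.1 hf m hm
  · refine le_iSup_of_le 0 fun f hf => Submodule.mem_colon.2 fun m _ => ?_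
    exact J.mul_mem_right m hf

/-- I(X) is saturated: at each point some coordinate is nonzero, and its `N`-th power can be
cancelled from the value of each homogeneous component. -/
theorem mem_pointsIdeal_of_mul_mem {X : Finset (Plane k)} {f : CoordRing k} {N : ℕ}
    (h : ∀ m ∈ idealOfVars (Fin 3) k ^ N, m * f ∈ pointsIdeal X) : f ∈ pointsIdeal X := by
  rw [← sum_homogeneousComponent f]
  refine Ideal.sum_mem _ fun n _ =>
    mem_pointsIdeal_of_form (homogeneousComponent_isHomogeneous n f) fun P hP => ?_
  obtain ⟨i, hi⟩ : ∃ i, P.rep i ≠ 0 := by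
    by_contra! hc
    exact P.rep_nonzero (funext hc)
  have h1 := hasComponents_pointsIdeal X _
    (h (MvPolynomial.X i ^ N) (Ideal.pow_mem_pow (Ideal.subset_span (Set.mem_range_self i)) N)) ((N + n : ℕ) : ℤ)
  rw [homComp_mul (isHomogeneous_X_pow i N), Nat.cast_add, add_sub_cancel_left,
    homComp_natCast] at h1
  have h2 := eval_eq_zero_of_mem_pointsIdeal h1 hP
  rw [map_mul, map_pow, eval_X] at h2
  exact (mul_eq_zero.1 h2).resolve_left (pow_ne_zero _ hi)

/-- The linear form with coefficients `c`. -/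
noncomputable def linForm (c : Fin 3 → k) : CoordRing k := ∑ i, C (c i) * X i

theorem isHomogeneous_linForm (c : Fin 3 → k) : (linForm c).IsHomogeneous 1 :=
  IsHomogeneous.sum _ _ _ fun i _ => isHomogeneous_C_mul_X (c i) i

theorem eval_linForm (c p : Fin 3 → k) : eval p (linForm c) = c ⬝ᵥ p := by
  simp [linForm, dotProduct]

theorem exists_dotProduct_ne_zero {p v : Fin 3 → k} (h : v ∉ Submodule.span k {p}) :
    ∃ c : Fin 3 → k, c ⬝ᵥ p = 0 ∧ c ⬝ᵥ v ≠ 0 := by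
  obtain ⟨L, hL, hL2⟩ := Submodule.exists_le_ker_of_notMem h
  have key : ∀ x, (fun i => L (Pi.single i 1)) ⬝ᵥ x = L x := fun x => by
    conv_rhs => rw [← Finset.univ_sum_single x, map_sum]
    refine Finset.sum_congr rfl fun i _ => ?_
    rw [mul_comm, ← smul_eq_mul, ← map_smul, ← Pi.single_smul]
    simp
  refine ⟨fun i => L (Pi.single i 1), ?_, ?_⟩
  · rw [key]; exact hL2 (Submodule.mem_span_singleton_self p)
  · rwa [key]

theorem rep_notMem_span {P Q : Plane k} (h : P ≠ Q) : P.rep ∉ Submodule.span k {Q.rep} := by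
  intro hm
  obtain ⟨a, ha⟩ := Submodule.mem_span_singleton.1 hm
  apply h
  rw [← P.mk_rep, ← Q.mk_rep, Projectivization.mk_eq_mk_iff']
  exact ⟨a, ha⟩

/-- Some form vanishes at the points of a finite set, but not at a given point outside it. -/
theorem exists_form_separating (Y : Finset (Plane k)) {P : Plane k} (hP : P ∉ Y) :
    ∃ (d : ℕ) (H : CoordRing k), H.IsHomogeneous d ∧ (∀ Q ∈ Y, eval Q.rep H = 0) ∧
      eval P.rep H ≠ 0 := by
  have h : ∀ Q : Plane k, ∃ c : Fin 3 → k, Q ∈ Y → c ⬝ᵥ Q.rep = 0 ∧ c ⬝ᵥ P.rep ≠ 0 := fun Q => by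
    by_cases hQ : Q ∈ Y
    · obtain ⟨c, hc⟩ := exists_dotProduct_ne_zero
        (rep_notMem_span (P := P) (Q := Q) fun h => hP (h ▸ hQ))
      exact ⟨c, fun _ => hc⟩
    · exact ⟨0, fun h => absurd h hQ⟩
  choose c hc using h
  refine ⟨_, ∏ Q ∈ Y, linForm (c Q), IsHomogeneous.prod _ _ _ fun Q _ => isHomogeneous_linForm _,
    fun Q hQ => ?_, ?_⟩
  · rw [map_prod]
    exact Finset.prod_eq_zero hQ (by rw [eval_linForm]; exact (hc Q hQ).1)
  · rw [map_prod, Finset.prod_ne_zero_iff]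
    intro Q hQ
    rw [eval_linForm]
    exact (hc Q hQ).2

/-! ### Directional derivatives and singular points. -/

/-- The derivative of `f` at the point `p` in the direction `v`. -/
noncomputable def dirDeriv (p v : Fin 3 → k) (f : CoordRing k) : k :=
  (fun i => eval p (pderiv i f)) ⬝ᵥ v

theorem dirDeriv_add (p v : Fin 3 → k) (f g : CoordRing k) :
    dirDeriv p v (f + g) = dirDeriv p v f + dirDeriv p v g := by
  simp [dirDeriv, dotProduct, add_mul, Finset.sum_add_distrib]

theorem dirDeriv_mul (p v : Fin 3 → k) (f g : CoordRing k) :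
    dirDeriv p v (f * g) = eval p f * dirDeriv p v g + eval p g * dirDeriv p v f := by
  simp only [dirDeriv, dotProduct, Derivation.leibniz, smul_eq_mul, map_add, map_mul,
    Finset.mul_sum, ← Finset.sum_add_distrib]
  exact Finset.sum_congr rfl fun i _ => by ring

theorem dirDeriv_linForm (p v c : Fin 3 → k) : dirDeriv p v (linForm c) = c ⬝ᵥ v := by
  simp [dirDeriv, linForm, dotProduct, pderiv_X, Pi.single_apply]

/-- The kernel of one functional on k³ has dimension at least 2, too large for the span of `p`. -/
theorem exists_direction (w p : Fin 3 → k) : ∃ v, w ⬝ᵥ v = 0 ∧ v ∉ Submodule.span k {p} := by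
  by_contra! h
  have hle : LinearMap.ker (dotProductBilin k k w) ≤ Submodule.span k {p} := fun v hv => h v hv
  have h1 := Submodule.finrank_mono hle
  have h2 := finrank_span_le_card (R := k) ({p} : Set (Fin 3 → k))
  have h3 := LinearMap.finrank_range_add_finrank_ker (dotProductBilin k k w)
  have h4 := (LinearMap.range (dotProductBilin k k w)).finrank_le
  simp at h2 h3 h4
  omega

/-- If the ideal of a finite set of points is generated by two elements, then neither generator is
singular at one of the points. -/
theorem not_isSingularPoint_of_mem {X : Finset (Plane k)} {F G : CoordRing k}
    (hI : pointsIdeal X = Ideal.span {F, G}) {P : Plane k} (hP : P ∈ X) :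
    ¬ IsSingularPoint F P := by
  rintro ⟨hF, hdF⟩
  classical
  obtain ⟨v, hv, hvP⟩ := exists_direction (fun i => eval P.rep (pderiv i G)) P.rep
  have hG : eval P.rep G = 0 :=
    eval_eq_zero_of_mem_pointsIdeal (hI ▸ Ideal.subset_span (by simp)) hP
  have hdF' : dirDeriv P.rep v F = 0 := by
    simp only [VanishesAt] at hdF
    simp [dirDeriv, hdF, dotProduct]
  have hall : ∀ f ∈ pointsIdeal X, dirDeriv P.rep v f = 0 := fun f hf => by
    rw [hI] at hf
    obtain ⟨a, b, rfl⟩ := Ideal.mem_span_pair.1 hf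
    have hG' : dirDeriv P.rep v G = 0 := hv
    rw [dirDeriv_add, dirDeriv_mul, dirDeriv_mul, hdF', hG', hG, show eval P.rep F = 0 from hF]
    ring
  -- A line through `P` transversal to `v`, times a form vanishing on the rest of `X` but not at
  -- `P`, lies in I(X) and has nonzero derivative along `v`.
  obtain ⟨c, hcP, hcv⟩ := exists_dotProduct_ne_zero hvP
  obtain ⟨d, H, hH, hHX, hHP⟩ := exists_form_separating (X.erase P) (Finset.notMem_erase P X)
  have hmem : H * linForm c ∈ pointsIdeal X := by
    refine mem_pointsIdeal_of_form (hH.mul (isHomogeneous_linForm c)) fun Q hQ => ?_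
    rw [VanishesAt, map_mul]
    by_cases hQP : Q = P
    · rw [hQP, eval_linForm, hcP, mul_zero]
    · rw [hHX Q (Finset.mem_erase.2 ⟨hQP, hQ⟩), zero_mul]
  have := hall _ hmem
  rw [dirDeriv_mul, dirDeriv_linForm, eval_linForm, hcP, zero_mul, add_zero] at this
  exact mul_ne_zero hHP hcv this

/-! ### The square of a complete intersection and its saturation. -/

/-- Of the generators F², FG, G², the first two are absorbed in F·(F, G); this is the shape that
`pieceDim_of_prime` requires. -/
theorem mem_span_pair_sq {F G f : CoordRing k} :
    f ∈ Ideal.span {F, G} ^ 2 ↔ ∃ j ∈ Ideal.span {F, G}, ∃ r, f = F * j + G ^ 2 * r := by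
  constructor
  · intro hf
    rw [pow_two] at hf
    refine Submodule.mul_induction_on hf ?_ ?_
    · intro x hx y hy
      obtain ⟨a, b, rfl⟩ := Ideal.mem_span_pair.1 hx
      obtain ⟨c, d, rfl⟩ := Ideal.mem_span_pair.1 hy
      exact ⟨(a * c) * F + (a * d + b * c) * G, Ideal.mem_span_pair.2 ⟨_, _, rfl⟩, b * d, by ring⟩
    · rintro _ _ ⟨j, hj, r, rfl⟩ ⟨j', hj', r', rfl⟩
      exact ⟨j + j', add_mem hj hj', r + r', by ring⟩
  · rintro ⟨j, hj, r, rfl⟩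
    have hF : F ∈ Ideal.span {F, G} := Ideal.subset_span (by simp)
    have hG : G ∈ Ideal.span {F, G} := Ideal.subset_span (by simp)
    refine add_mem ?_ (Ideal.mul_mem_right _ _ (Ideal.pow_mem_pow hG 2))
    rw [pow_two]
    exact Ideal.mul_mem_mul hF hj

/-- If `a F + b G` lies in `(F, G)²`, for a regular sequence `F, G`, then `a` and `b` lie in
`(F, G)`. -/
theorem mem_of_add_mem_sq {F G a b : CoordRing k} (hF : Prime F) (hFG : ¬ F ∣ G)
    (h : a * F + b * G ∈ Ideal.span {F, G} ^ 2) :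
    a ∈ Ideal.span {F, G} ∧ b ∈ Ideal.span {F, G} := by
  obtain ⟨j, hj, r, hr⟩ := mem_span_pair_sq.1 h
  -- The relation `hr` rearranges to `G * (G * r - b) = F * (a - j)`.
  obtain ⟨s, hs⟩ := (hF.dvd_or_dvd (⟨a - j, by linear_combination -hr⟩ :
    F ∣ G * (G * r - b))).resolve_left hFG
  have ha : a = j + G * s := by
    apply mul_left_cancel₀ hF.ne_zero
    linear_combination hr + G * hs
  have hF' : F ∈ Ideal.span {F, G} := Ideal.subset_span (by simp)
  have hG' : G ∈ Ideal.span {F, G} := Ideal.subset_span (by simp)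
  constructor
  · rw [ha]
    exact add_mem hj (Ideal.mul_mem_right _ _ hG')
  · rw [show b = G * r - F * s by linear_combination -hs]
    exact sub_mem (Ideal.mul_mem_right _ _ hG') (Ideal.mul_mem_right _ _ hF')

/-- The square of the ideal of a complete intersection of points is saturated. -/
theorem fatPointIdeal_two_eq {X : Finset (Plane k)} {F G : CoordRing k} (hF : Prime F)
    (hFG : ¬ F ∣ G) (hI : pointsIdeal X = Ideal.span {F, G}) :
    fatPointIdeal 2 X = Ideal.span {F, G} ^ 2 := by
  rw [fatPointIdeal, hI]
  refine saturation_eq_self fun f N h => ?_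
  have hfI : f ∈ pointsIdeal X := mem_pointsIdeal_of_mul_mem fun m hm => by
    rw [hI]; exact Ideal.pow_le_self two_ne_zero (h m hm)
  rw [hI] at hfI
  obtain ⟨a, b, rfl⟩ := Ideal.mem_span_pair.1 hfI
  have hab : ∀ m ∈ idealOfVars (Fin 3) k ^ N,
      m * a ∈ Ideal.span {F, G} ∧ m * b ∈ Ideal.span {F, G} := fun m hm =>
    mem_of_add_mem_sq hF hFG (by
      rw [show m * a * F + m * b * G = m * (a * F + b * G) by ring]; exact h m hm)
  have ha : a ∈ pointsIdeal X := mem_pointsIdeal_of_mul_mem fun m hm => hI ▸ (hab m hm).1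
  have hb : b ∈ pointsIdeal X := mem_pointsIdeal_of_mul_mem fun m hm => hI ▸ (hab m hm).2
  rw [hI] at ha hb
  rw [pow_two]
  exact add_mem (Ideal.mul_mem_mul ha (Ideal.subset_span (by simp)))
    (Ideal.mul_mem_mul hb (Ideal.subset_span (by simp)))
-- Hilbert functions of (F, G) and of its square.
/-- The graded pieces of a complete intersection `(F, G)`. -/
theorem pieceDim_span_pair {F G : CoordRing k} {e b : ℕ} (hF : F.IsHomogeneous e) (hFp : Prime F)
    (hG : G.IsHomogeneous b) (hFG : ¬ F ∣ G) (z : ℤ) :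
    pieceDim (Ideal.span {F, G}) z =
      formsDim k (z - e) + formsDim k (z - b) - formsDim k (z - e - b) := by
  rw [← pieceDim_top (z - e)]
  refine pieceDim_of_prime hF hFp hG hFG (fun _ _ _ => Submodule.mem_top) Submodule.mem_top
    (fun f => ?_) z
  rw [Ideal.mem_span_pair]
  constructor
  · rintro ⟨a, b, rfl⟩
    exact ⟨a, Submodule.mem_top, b, by ring⟩
  · rintro ⟨a, -, b, rfl⟩
    exact ⟨a, b, by ring⟩

/-- The graded pieces of the square of a complete intersection `(F, G)`. -/
theorem pieceDim_span_pair_sq {F G : CoordRing k} {e b : ℕ} (hF : F.IsHomogeneous e)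
    (hFp : Prime F) (hG : G.IsHomogeneous b) (hFG : ¬ F ∣ G) (z : ℤ) :
    pieceDim (Ideal.span {F, G} ^ 2) z = pieceDim (Ideal.span {F, G}) (z - e) +
      formsDim k (z - b * 2) - formsDim k (z - e - b * 2) := by
  have h := pieceDim_of_prime hF hFp (hG.pow 2) (fun h => hFG (hFp.dvd_of_dvd_pow h))
    (J₀ := Ideal.span {F, G}) (hasComponents_span (by
      rintro f (rfl | rfl)
      exacts [⟨e, hF⟩, ⟨b, hG⟩]))
    (Ideal.pow_mem_of_mem _ (Ideal.subset_span (by simp)) 2 two_pos)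
    (fun f => mem_span_pair_sq) z
  exact_mod_cast h

/-! ### Recovering the complete intersection from the Hilbert function. -/

/-- The first differences of the Hilbert function determine the dimensions of the graded pieces. -/
theorem pieceDim_eq_of_diffFun {I : Ideal (CoordRing k)} {t : ℕ} (ht : 3 ≤ t)
    (hI : ∀ d : ℕ, diffFun I d = ciSeq t d) (z : ℤ) :
    pieceDim I z = formsDim k (z - 3) + formsDim k (z - t) - formsDim k (z - 3 - t) := by
  rcases lt_or_ge z 0 with hz | hz
  · rw [pieceDim_of_neg _ hz, formsDim_of_neg (by omega), formsDim_of_neg (by omega),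
      formsDim_of_neg (by omega)]
    rfl
  · lift z to ℕ using hz
    induction z with
    | zero =>
      have h := hI 0
      rw [diffFun_eq, pieceDim_of_neg (z := ((0 : ℕ) : ℤ) - 1) _ (by simp)] at h
      rw [formsDim_of_neg (by simp), formsDim_of_neg (by simp; omega),
        formsDim_of_neg (by simp; omega)]
      simp only [ciSeq] at h
      simp at h ⊢
      omega
    | succ n ih =>
      have h := hI (n + 1)
      rw [diffFun_eq, show ((n + 1 : ℕ) : ℤ) - 1 = (n : ℕ) by push_cast; ring] at h
      have h1 := formsDim_sub (k := k) (((n + 1 : ℕ) : ℤ) - 3)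
      have h2 := formsDim_sub (k := k) (((n + 1 : ℕ) : ℤ) - t)
      have h3 := formsDim_sub (k := k) (((n + 1 : ℕ) : ℤ) - 3 - t)
      rw [show ((n + 1 : ℕ) : ℤ) - 3 - 1 = n - 3 by push_cast; ring] at h1
      rw [show ((n + 1 : ℕ) : ℤ) - t - 1 = n - t by push_cast; ring] at h2
      rw [show ((n + 1 : ℕ) : ℤ) - 3 - t - 1 = n - 3 - t by push_cast; ring] at h3
      simp only [ciSeq] at h
      split_ifs at h <;> first | contradiction | omega

/-- If a homogeneous piece of an ideal is larger than that of `(F)`, then it has an element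
which is not a multiple of `F`. -/
theorem exists_mem_piece_not_dvd {F : CoordRing k} {e : ℕ} (hF : F.IsHomogeneous e)
    (hF0 : F ≠ 0) {I : Ideal (CoordRing k)} {z : ℤ} (h : formsDim k (z - e) < pieceDim I z) :
    ∃ G ∈ piece I z, ¬ F ∣ G := by
  by_contra! hc
  have hle : piece I z ≤ (forms k (z - e)).map (mulLin F) := by
    intro f hf
    obtain ⟨g, rfl⟩ := hc f hf
    refine ⟨homComp (z - e) g, homComp_mem_forms _ _, ?_⟩
    rw [LinearMap.mulLeft_apply, ← homComp_mul hF, homComp_eq_self hf.2]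
  have := Submodule.finrank_mono hle
  rw [finrank_map_mulLin hF0] at this
  rw [formsDim, pieceDim] at h
  omega

/-- `G` is a nonzerodivisor modulo `F` because `F` is prime and does not divide it. -/
theorem isRegular_pair {F G : CoordRing k} (hF : Prime F) (hFG : ¬ F ∣ G)
    (h : Ideal.span {F, G} ≠ ⊤) : RingTheory.Sequence.IsRegular (CoordRing k) [F, G] := by
  refine ⟨?_, ?_⟩
  · rw [RingTheory.Sequence.isWeaklyRegular_cons_iff,
      RingTheory.Sequence.isWeaklyRegular_singleton_iff]
    refine ⟨fun a b hab => mul_left_cancel₀ hF.ne_zero hab, ?_⟩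
    rw [isSMulRegular_quotient_iff_mem_of_smul_mem]
    intro x hx
    rw [Submodule.mem_smul_pointwise_iff_exists] at hx ⊢
    obtain ⟨y, -, hy⟩ := hx
    obtain ⟨s, hs⟩ := (hF.dvd_or_dvd (⟨y, hy.symm⟩ : F ∣ G * x)).resolve_left hFG
    exact ⟨s, Submodule.mem_top, hs.symm⟩
  · have hl : Ideal.ofList [F, G] = Ideal.span {F, G} := by
      rw [Ideal.ofList_cons, Ideal.ofList_singleton, Ideal.span_insert]
    rw [hl, smul_eq_mul, Ideal.mul_top]
    exact h.symm

theorem pointsIdeal_ne_top {X : Finset (Plane k)} (hX : X.Nonempty) : pointsIdeal X ≠ ⊤ := by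
  obtain ⟨P, hP⟩ := hX
  intro h
  have := eval_eq_zero_of_mem_pointsIdeal (h ▸ Submodule.mem_top : (1 : CoordRing k) ∈ _) hP
  simp at this

/-- Points on an irreducible cubic whose Hilbert function is that of a complete intersection of
type `(3, t)` form such a complete intersection. -/
theorem exists_pointsIdeal_eq_span_pair {F : CoordRing k} (hF : F.IsHomogeneous 3)
    (hFp : Prime F) {t : ℕ} (ht : 3 ≤ t) {X : Finset (Plane k)} (hXF : ∀ P ∈ X, VanishesAt F P)
    (hX : ∀ d : ℕ, diffFun (pointsIdeal X) d = ciSeq t d) :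
    ∃ G : CoordRing k, G.IsHomogeneous t ∧ ¬ F ∣ G ∧ pointsIdeal X = Ideal.span {F, G} := by
  have hdim := pieceDim_eq_of_diffFun ht hX
  -- In degree `t` the formula gives dim R_{t-3} + dim R_0, exceeding the multiples of `F` by
  -- exactly 1.
  obtain ⟨G, hG, hFG⟩ := exists_mem_piece_not_dvd (I := pointsIdeal X) (z := t) hF hFp.ne_zero (by
    have h0 := formsDim_sub (k := k) 0
    rw [formsDim_of_neg (z := 0 - 1) (by norm_num)] at h0
    rw [hdim, sub_self, formsDim_of_neg (z := (t : ℤ) - 3 - t) (by omega)]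
    push_cast
    omega)
  have hGt : G.IsHomogeneous t := by
    have := hG.2
    rwa [forms_natCast] at this
  refine ⟨G, hGt, hFG, (eq_of_le_of_pieceDim_eq (hasComponents_pointsIdeal X) ?_ fun z => ?_).symm⟩
  · rw [Ideal.span_le]
    rintro f (rfl | rfl)
    exacts [mem_pointsIdeal_of_form hF hXF, hG.1]
  · rw [pieceDim_span_pair hF hFp hGt hFG, hdim]
    norm_num

/-! ### The difference function of 2X. -/

/-- The first differences of the Hilbert function of the square of a complete intersection of
type `(3, t)`. -/
theorem diffFun_span_pair_sq {F G : CoordRing k} {t : ℕ} (hF : F.IsHomogeneous 3)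
    (hFp : Prime F) (hG : G.IsHomogeneous t) (hFG : ¬ F ∣ G) (d : ℕ) :
    diffFun (Ideal.span {F, G} ^ 2) d = max ((d : ℤ) + 1) 0 - max ((d : ℤ) - 5) 0
      - max ((d : ℤ) - 2 - t) 0 + max ((d : ℤ) - 5 - t) 0 - max ((d : ℤ) + 1 - 2 * t) 0
      + max ((d : ℤ) - 2 - 2 * t) 0 := by
  have key : ∀ c a : ℤ, a = d - c + 1 →
      formsDim k (d - c) = formsDim k (d - 1 - c) + max a 0 := fun c a ha => by
    have h := formsDim_sub (k := k) (d - c)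
    rw [show (d : ℤ) - c - 1 = d - 1 - c by ring] at h
    rw [ha]
    omega
  -- Positive shifts are the degrees 6, t+3, 2t of F², FG, G²; negative ones are the degrees t+6,
  -- 2t+3 of the syzygies G·F² = F·FG and G·FG = F·G².
  have hp : ∀ z : ℤ, pieceDim (Ideal.span {F, G} ^ 2) z = formsDim k (z - 6) +
      formsDim k (z - (3 + t)) - formsDim k (z - (6 + t)) + formsDim k (z - 2 * t) -
      formsDim k (z - (3 + 2 * t)) := fun z => by
    rw [pieceDim_span_pair_sq hF hFp hG hFG, pieceDim_span_pair hF hFp hG hFG]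
    push_cast
    ring_nf
  rw [diffFun_eq, hp, hp, key 6 (d - 5) (by ring), key (3 + t) (d - 2 - t) (by ring),
    key (6 + t) (d - 5 - t) (by ring), key (2 * t) (d + 1 - 2 * t) (by ring),
    key (3 + 2 * t) (d - 2 - 2 * t) (by ring)]
  ring

end FatPoints

theorem proposition3p1 {k : Type*} [Field k]
    -- an irreducible plane cubic
    (F : FatPoints.CoordRing k) (hFdeg : F.IsHomogeneous 3) (hFirr : Irreducible F)
    -- a reduced set of `3t` points on it
    (t : ℕ) (ht : 3 ≤ t)
    (X : Finset (FatPoints.Plane k)) (hXcard : X.card = 3 * t)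
    (hXF : ∀ P ∈ X, FatPoints.VanishesAt F P)
    -- with difference function `1, 2, 3, …, 3, 2, 1`
    (hX : ∀ d : ℕ, FatPoints.diffFun (FatPoints.pointsIdeal X) d = FatPoints.ciSeq t d) :
    -- `X` is a complete intersection with ideal `(F, G)`, `deg G = t`
    (∃ G : FatPoints.CoordRing k, G.IsHomogeneous t ∧
      RingTheory.Sequence.IsRegular (FatPoints.CoordRing k) [F, G] ∧
      FatPoints.pointsIdeal X = Ideal.span {F, G}) ∧
    -- no point of `X` is a singular point of the cubic
    (∀ P : FatPoints.Plane k, FatPoints.IsSingularPoint F P → P ∉ X) ∧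
    -- the difference function of `Z = 2X`
    (t = 3 → ∀ d : ℕ, FatPoints.diffFun (FatPoints.fatPointIdeal 2 X) d =
      ([1, 2, 3, 4, 5, 6, 4, 2] : List ℤ).getD d 0) ∧
    (t = 4 → ∀ d : ℕ, FatPoints.diffFun (FatPoints.fatPointIdeal 2 X) d =
      ([1, 2, 3, 4, 5, 6, 6, 5, 3, 1] : List ℤ).getD d 0) ∧
    (t = 5 → ∀ d : ℕ, FatPoints.diffFun (FatPoints.fatPointIdeal 2 X) d =
      ([1, 2, 3, 4, 5, 6, 6, 6, 5, 4, 2, 1] : List ℤ).getD d 0) ∧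
    (6 ≤ t → ∀ d : ℕ, FatPoints.diffFun (FatPoints.fatPointIdeal 2 X) d =
      FatPoints.doubleSeq t d) := by
  have hFp : Prime F := hFirr.prime
  obtain ⟨G, hG, hFG, hI⟩ := FatPoints.exists_pointsIdeal_eq_span_pair hFdeg hFp ht hXF hX
  have hne : X.Nonempty := Finset.card_pos.1 (by omega)
  have hZ := FatPoints.diffFun_span_pair_sq hFdeg hFp hG hFG
  rw [← FatPoints.fatPointIdeal_two_eq hFp hFG hI] at hZ
  refine ⟨⟨G, hG, FatPoints.isRegular_pair hFp hFG (hI ▸ FatPoints.pointsIdeal_ne_top hne), hI⟩,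
    fun P hP hPX => FatPoints.not_isSingularPoint_of_mem hI hPX hP, ?_, ?_, ?_, ?_⟩
  -- The sequence drops by one per degree from t+2 to t+5 and from 2t-1 to 2t+2. These ranges
  -- overlap exactly when t ≤ 5, hence the three special cases; each list has length 2t+2.
  · rintro rfl d
    rw [hZ]
    rcases lt_or_ge d 8 with hd | hd
    · interval_cases d <;> simp
    · rw [List.getD_eq_default _ _ (by simpa using hd)]
      omega
  · rintro rfl d
    rw [hZ]
    rcases lt_or_ge d 10 with hd | hd
    · interval_cases d <;> simp
    · rw [List.getD_eq_default _ _ (by simpa using hd)]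
      omega
  · rintro rfl d
    rw [hZ]
    rcases lt_or_ge d 12 with hd | hd
    · interval_cases d <;> simp
    · rw [List.getD_eq_default _ _ (by simpa using hd)]
      omega
  · intro ht6 d
    rw [hZ, FatPoints.doubleSeq]
    split_ifs <;> omega
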